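/- **Theorem 1 (Asymptotic Lower Bound).** Consider the stochastic contextual linear bandit with $M$ contexts. In context $m\in[M]$ the learner has a known action set $\mathcal A^m\subset\mathbb R^d$ with $|\mathcal A^m|=K$, where each $\mathcal A^m$ spans $\mathbb R^d$ and $\|x\|_2\le 1$ for all $x\in\mathcal A^m$. For a horizon $n$, in each round $t=1,\dots,n$ a context $c_t$ is drawn independently from a distribution $p$ on $[M]$ and revealed. Using its past observations and $c_t$ (and possibly the horizon and internal randomisation) the policy $\pi$ chooses $X_t\in\mathcal A^{c_t}$, and it then observes $Y_t=\langle X_t,\theta\rangle+\eta_t$, where the $\eta_t$ are independent standard Gaussian variables and $\theta\in\mathbb R^d$. The expected regret is $$R_\theta^\pi(n)=\mathbb E\Big[\sum_{t=1}^n\max_{x\in\mathcal A^{c_t}}\langle x,\theta\rangle-\sum_{t=1}^nY_t\Big].$$ The policy $\pi$ is called consistent if, for every context distribution giving positive probability to every context, every parameter in $\mathbb R^d$ and every $\epsilon>0$, its regret is $o(n^\epsilon)$ as $n\to\infty$. Suppose that $p(m)>0$ for all $m\in[M]$, that for each $m$ the optimal arm $x_m^*=\operatorname{argmax}_{x\in\mathcal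 A^m}\langle x,\theta\rangle$ is unique, and that $\pi$ is consistent. Let $\Delta_x^m=\langle x_m^*-x,\theta\rangle$. Then $$\liminf_{n\to\infty}\frac{R_\theta^\pi(n)}{\log n}\ \ge\ \mathcal C(\theta,\mathcal A^1,\dots,\mathcal A^M),$$ where $\mathcal C(\theta,\mathcal A^1,\dots,\mathcal A^M)$ is the optimal value of $$\inf_{\alpha_{x,m}\in[0,\infty]}\ \sum_{m=1}^M\sum_{x\in\mathcal A^m}\alpha_{x,m}\Delta_x^m$$ subject to the constraint that, for every context $m$ and every suboptimal arm $x\in\mathcal A^m$ (that is, $\Delta_x^m>0$), $$x^\top\Big(\sum_{m'=1}^M\sum_{y\in\mathcal A^{m'}}\alpha_{y,m'}\,yy^\top\Big)^{-1}x\ \le\ \frac{(\Delta_x^m)^2}{2}.$$ Here $\infty\cdot 0=0$. For an allocation with infinite entries the left-hand side of the constraint is the limit as $N\to\infty$ of its value for the truncated allocation $\min(\alpha_{x,m},N)$. The matrix (for the truncated allocations, with $N$ large) is required to be invertible. -/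

import Mathlib

open MeasureTheory ProbabilityTheory Filter Topology Asymptotics
open scoped ENNReal NNReal BigOperators

namespace ContextualBandit

/-- What happens in one round: the context `c`, the index `k` of the chosen arm and the observed
reward `y`, stored as `((c, k), y)`. -/
abbrev Round (M K : ℕ) : Type := (Fin M × Fin K) × ℝ

/-- The observations of the first `t` rounds. -/
abbrev History (M K t : ℕ) : Type := Fin t → Round M K

/-- The action sets: `arms m` enumerates the `K` actions that are available in context `m`. -/
abbrev ActionSets (M K d : ℕ) : Type := Fin M → Fin K → EuclideanSpace ℝ (Fin d)

/-- A (possibly randomised, possibly horizon-dependent) policy: when the horizon is `n`,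
`select n t` is the conditional distribution of the arm that is chosen in the round that follows
`t` completed rounds, given these rounds and the current context. -/
structure Policy (M K : ℕ) where
  select : (n t : ℕ) → Kernel (History M K t × Fin M) (Fin K)
  isMarkov : ∀ n t, IsMarkovKernel (select n t)

attribute [instance] Policy.isMarkov

section Interaction

variable {M K d : ℕ}

/-- The reward `⟨x, θ⟩ + η`, `η` standard Gaussian, when `x` is the arm with index `z.2` in
context `z.1`. -/
noncomputable def rewardKernel (arms : ActionSets M K d) (θ : EuclideanSpace ℝ (Fin d)) :
    Kernel (Fin M × Fin K) ℝ where
  toFun z := gaussianReal (inner ℝ (arms z.1 z.2) θ) 1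
  measurable' := measurable_of_countable _

instance (arms : ActionSets M K d) (θ : EuclideanSpace ℝ (Fin d)) :
    IsMarkovKernel (rewardKernel arms θ) :=
  ⟨fun z => inferInstanceAs (IsProbabilityMeasure (gaussianReal (inner ℝ (arms z.1 z.2) θ) 1))⟩

/-- One round of interaction given the past: draw the context from `p`, let the policy choose
an arm, and draw the reward. -/
noncomputable def roundKernel (arms : ActionSets M K d) (π : Policy M K) (p : PMF (Fin M))
    (θ : EuclideanSpace ℝ (Fin d)) (n t : ℕ) : Kernel (History M K t) (Round M K) :=
  (Kernel.const (History M K t) p.toMeasure ⊗ₖ π.select n t) ⊗ₖ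
    Kernel.prodMkLeft (History M K t) (rewardKernel arms θ)

instance (arms : ActionSets M K d) (π : Policy M K) (p : PMF (Fin M))
    (θ : EuclideanSpace ℝ (Fin d)) (n t : ℕ) : IsMarkovKernel (roundKernel arms π p θ n t) := by
  unfold roundKernel
  infer_instance

/-- The law of the first `t` rounds when `π` is run with horizon `n` in the bandit with
parameter `θ` and context distribution `p`. -/
noncomputable def historyLaw (arms : ActionSets M K d) (π : Policy M K) (p : PMF (Fin M))
    (θ : EuclideanSpace ℝ (Fin d)) (n : ℕ) : (t : ℕ) → Measure (History M K t)
  | 0 => Measure.dirac Fin.elim0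
  | t + 1 => (historyLaw arms π p θ n t ⊗ₘ roundKernel arms π p θ n t).map
      (fun z => (Fin.snoc z.1 z.2 : History M K (t + 1)))

theorem measurable_snoc (t : ℕ) :
    Measurable (fun z : History M K t × Round M K =>
      (Fin.snoc z.1 z.2 : History M K (t + 1))) := by
  refine measurable_pi_lambda _ fun i => ?_
  refine Fin.lastCases ?_ (fun j => ?_) i
  · simpa using measurable_snd
  · simpa using! (measurable_pi_apply j).comp measurable_fst

instance isProbabilityMeasure_historyLaw (arms : ActionSets M K d) (π : Policy M K)
    (p : PMF (Fin M)) (θ : EuclideanSpace ℝ (Fin d)) (n t : ℕ) :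
    IsProbabilityMeasure (historyLaw arms π p θ n t) := by
  induction t with
  | zero => unfold historyLaw; infer_instance
  | succ t ih =>
    unfold historyLaw
    exact Measure.isProbabilityMeasure_map (measurable_snoc t).aemeasurable

/-- The largest mean reward `max_{x ∈ A^m} ⟨x, θ⟩` in context `m`. -/
noncomputable def optimalMean (arms : ActionSets M K d) (θ : EuclideanSpace ℝ (Fin d))
    (m : Fin M) : ℝ :=
  ⨆ k, inner ℝ (arms m k) θ

/-- The suboptimality gap of the arm with index `k` in context `m`. -/
noncomputable def gap (arms : ActionSets M K d) (θ : EuclideanSpace ℝ (Fin d))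
    (m : Fin M) (k : Fin K) : ℝ :=
  optimalMean arms θ m - inner ℝ (arms m k) θ

/-- The cumulative expected regret `𝔼[∑_{t ≤ n} ⟨x*_{c_t}, θ⟩ - ∑_{t ≤ n} Y_t]` at horizon `n`. -/
noncomputable def regret (arms : ActionSets M K d) (π : Policy M K) (p : PMF (Fin M))
    (θ : EuclideanSpace ℝ (Fin d)) (n : ℕ) : ℝ :=
  ∫ h, ((∑ t, optimalMean arms θ (h t).1.1) - ∑ t, (h t).2) ∂(historyLaw arms π p θ n n)

/-- The policy is consistent for the given action sets: its regret is `o(n ^ ε)` for every `ε > 0`,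
for all parameters and all context distributions (which give positive mass to every context). -/
def IsConsistent (arms : ActionSets M K d) (π : Policy M K) : Prop :=
  ∀ p : PMF (Fin M), (∀ m, 0 < p m) → ∀ θ : EuclideanSpace ℝ (Fin d), ∀ ε : ℝ, 0 < ε →
    (fun n : ℕ => regret arms π p θ n) =o[atTop] (fun n : ℕ => (n : ℝ) ^ ε)

end Interaction

section Program

variable {M K d : ℕ}

/-- The matrix `∑_{m, x} β_{x,m} x xᵀ` for finite weights `β`. -/
noncomputable def designMatrix (arms : ActionSets M K d) (β : Fin M → Fin K → ℝ) :
    Matrix (Fin d) (Fin d) ℝ :=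
  ∑ m, ∑ k, β m k • Matrix.vecMulVec (arms m k).ofLp (arms m k).ofLp

/-- The finite weights `min (α, N)`. -/
noncomputable def truncate (α : Fin M → Fin K → ℝ≥0∞) (N : ℕ) : Fin M → Fin K → ℝ :=
  fun m k => (min (α m k) (N : ℝ≥0∞)).toReal

/-- The constraint of the allocation program. For weights in `[0, ∞]` the quadratic form
`xᵀ (∑ α x xᵀ)⁻¹ x` is the limit of the quadratic forms for the weights `min (α, N)` as `N → ∞`;
when all weights are finite these agree with `α` for large `N`. -/
def IsFeasible (arms : ActionSets M K d) (θ : EuclideanSpace ℝ (Fin d))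
    (α : Fin M → Fin K → ℝ≥0∞) : Prop :=
  (∀ᶠ N : ℕ in atTop, IsUnit (designMatrix arms (truncate α N))) ∧
  ∀ m k, 0 < gap arms θ m k → ∃ L : ℝ,
    Tendsto (fun N : ℕ => (arms m k).ofLp ⬝ᵥ
      ((designMatrix arms (truncate α N))⁻¹.mulVec (arms m k).ofLp)) atTop (𝓝 L) ∧
    L ≤ gap arms θ m k ^ 2 / 2

/-- The optimal value of the allocation program (`∞ * 0 = 0` in `ℝ≥0∞`). -/
noncomputable def allocationValue (arms : ActionSets M K d) (θ : EuclideanSpace ℝ (Fin d)) :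
    ℝ≥0∞ :=
  ⨅ (α : Fin M → Fin K → ℝ≥0∞) (_ : IsFeasible arms θ α),
    ∑ m, ∑ k, α m k * ENNReal.ofReal (gap arms θ m k)

end Program

end ContextualBandit

/-!
A policy can only be consistent if it collects enough information to rule out every parameter under
which it would have to behave differently. Let `k` be the optimal arm of the context `m` under `θ`,
let `v` be a direction for which `k` is suboptimal under `θ + v`, and write `T z` for the number of
pulls of the arm `z`. Consistency forces `k` to be played in almost all visits of `m` under `θ`, and
in almost none under `θ + v`. Hence the two laws of the history are nearly singular, at the rate
`n ^ (-1 + o(1))`, and their relative entropy, which is `∑ z, ⟪z, v⟫ ^ 2 * 𝔼 (T z) / 2`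
(`integral_sum_logRatio`), is at least `(1 - o(1)) * log n` (`eventually_log_le_divergence`).

The quantitative step is `exp_neg_divergence_le`. Instead of testing with an event, the square root
of the likelihood ratio is split by the proportion of visits of `m` in which `k` is played. This
reduces the bound to the two regrets and to the variance of the number of visits of `m`.

If the liminf were smaller than the value of the program, the normalised numbers of pulls
`𝔼 (T z) / log n` of the suboptimal arms would have, along some horizons, a limit point `a` that
costs less than this value (`exists_subseq_tendsto_allocation`). Give the optimal arms infinite
weight: this is free, and restricts attention to directions `v` orthogonal to all optimal arms. For
these the entropy bound passes to the limit, and says `∑ z, a z * ⟪z, v⟫ ^ 2 ≥ 2` as soon as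
`⟪x, v⟫` exceeds the gap of some arm `x` (`two_le_of_tendsto_allocation`). This is the dual form of
`xᵀ G⁻¹ x ≤ Δ ^ 2 / 2` (`isFeasible_of_forall_sq_le`), so `a` is feasible, a contradiction.
-/

namespace ContextualBandit

variable {M K d : ℕ}

/-! ### The Gaussian likelihood ratio -/

theorem gaussianReal_add_eq_withDensity (μ a : ℝ) :
    gaussianReal (μ + a) 1 = (gaussianReal μ 1).withDensity
      (fun y => ENNReal.ofReal (Real.exp (a * (y - μ) - a ^ 2 / 2))) := by
  rw [gaussianReal_of_var_ne_zero _ one_ne_zero, gaussianReal_of_var_ne_zero _ one_ne_zero,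
    ← withDensity_mul _ (measurable_gaussianPDF _ _) (by fun_prop)]
  congr 1
  funext y
  simp only [gaussianPDF, gaussianPDFReal, Pi.mul_apply]
  rw [← ENNReal.ofReal_mul (by positivity), mul_assoc (√_)⁻¹, ← Real.exp_add]
  congr 3
  push_cast
  ring

/-! ### Numbers of pulls -/

/-- The inner product of `v` with the arm of index `z.2` in context `z.1`. -/
noncomputable def armInner (arms : ActionSets M K d) (v : EuclideanSpace ℝ (Fin d))
    (z : Fin M × Fin K) : ℝ :=
  inner ℝ (arms z.1 z.2) v

theorem armInner_add (arms : ActionSets M K d) (v w : EuclideanSpace ℝ (Fin d))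
    (z : Fin M × Fin K) : armInner arms (v + w) z = armInner arms v z + armInner arms w z :=
  inner_add_right _ _ _

/-- The number of rounds of `h` in which the context and the arm are `z`. -/
noncomputable def pulls {t : ℕ} (z : Fin M × Fin K) (h : History M K t) : ℝ :=
  ∑ i, if (h i).1 = z then 1 else 0

/-- The expected number of rounds, among the first `t`, in which the context and the arm
are `z`. -/
noncomputable def expPulls (arms : ActionSets M K d) (π : Policy M K) (p : PMF (Fin M))
    (θ : EuclideanSpace ℝ (Fin d)) (n t : ℕ) (z : Fin M × Fin K) : ℝ :=
  ∫ h, pulls z h ∂historyLaw arms π p θ n t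

/-- Logarithm of the likelihood ratio of one round, parameter `θ + v` against `θ`. -/
noncomputable def logRatio (arms : ActionSets M K d) (θ v : EuclideanSpace ℝ (Fin d))
    (r : Round M K) : ℝ :=
  armInner arms v r.1 * (r.2 - armInner arms θ r.1) - armInner arms v r.1 ^ 2 / 2

theorem measurable_comp_fst {Z : Type*} [Countable Z] [MeasurableSpace Z]
    [MeasurableSingletonClass Z] (f : Z → ℝ) : Measurable (fun r : Z × ℝ => f r.1) :=
  (measurable_of_countable f).comp measurable_fst

@[fun_prop]
theorem measurable_logRatio (arms : ActionSets M K d) (θ v : EuclideanSpace ℝ (Fin d)) :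
    Measurable (logRatio arms θ v) := by
  unfold logRatio
  have h1 := measurable_comp_fst (armInner arms v)
  have h2 := measurable_comp_fst (armInner arms θ)
  fun_prop

theorem measurable_pulls {t : ℕ} (z : Fin M × Fin K) :
    Measurable (pulls z : History M K t → ℝ) := by
  unfold pulls
  have h1 := measurable_comp_fst (fun z' : Fin M × Fin K => if z' = z then (1 : ℝ) else 0)
  exact Finset.measurable_sum _ fun i _ => h1.comp (measurable_pi_apply i)

theorem pulls_nonneg {t : ℕ} (z : Fin M × Fin K) (h : History M K t) : 0 ≤ pulls z h :=
  Finset.sum_nonneg fun i _ => by split_ifs <;> simp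

theorem pulls_le {t : ℕ} (z : Fin M × Fin K) (h : History M K t) : pulls z h ≤ t := by
  calc pulls z h ≤ ∑ _i : Fin t, (1 : ℝ) := Finset.sum_le_sum fun i _ => by split_ifs <;> simp
    _ = t := by simp

theorem integrable_pulls (arms : ActionSets M K d) (π : Policy M K) (p : PMF (Fin M))
    (θ : EuclideanSpace ℝ (Fin d)) (n t : ℕ) (z : Fin M × Fin K) :
    Integrable (pulls z) (historyLaw arms π p θ n t) :=
  Integrable.of_bound (measurable_pulls z).aestronglyMeasurable t <| ae_of_all _ fun h => by
    rw [Real.norm_of_nonneg (pulls_nonneg z h)]; exact pulls_le z h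

theorem expPulls_nonneg (arms : ActionSets M K d) (π : Policy M K) (p : PMF (Fin M))
    (θ : EuclideanSpace ℝ (Fin d)) (n t : ℕ) (z : Fin M × Fin K) :
    0 ≤ expPulls arms π p θ n t z :=
  integral_nonneg fun h => pulls_nonneg z h

/-- A sum over rounds of a function of the context and the arm, grouped by their value. -/
theorem sum_rounds_eq_sum_pulls {t : ℕ} (f : Fin M × Fin K → ℝ) (h : History M K t) :
    ∑ i, f (h i).1 = ∑ z, f z * pulls z h := by
  simp only [pulls, Finset.mul_sum]
  rw [Finset.sum_comm]
  simp

theorem integral_sum_rounds (arms : ActionSets M K d) (π : Policy M K) (p : PMF (Fin M))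
    (θ : EuclideanSpace ℝ (Fin d)) (n t : ℕ) (f : Fin M × Fin K → ℝ) :
    Integrable (fun h => ∑ i, f (h i).1) (historyLaw arms π p θ n t) ∧
    ∫ h, ∑ i, f (h i).1 ∂historyLaw arms π p θ n t = ∑ z, f z * expPulls arms π p θ n t z := by
  simp only [sum_rounds_eq_sum_pulls]
  have hi : ∀ z, Integrable (fun h : History M K t => f z * pulls z h)
      (historyLaw arms π p θ n t) := fun z => (integrable_pulls arms π p θ n t z).const_mul _
  refine ⟨integrable_finsetSum _ fun z _ => hi z, ?_⟩
  rw [integral_finsetSum _ fun z _ => hi z]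
  simp [expPulls, integral_const_mul]

/-! ### Likelihood ratio of histories -/

theorem sum_snoc {t : ℕ} (g : Round M K → ℝ) (h : History M K t) (r : Round M K) :
    ∑ i, g ((Fin.snoc h r : History M K (t + 1)) i) = ∑ i, g (h i) + g r := by
  rw [Fin.sum_univ_castSucc]
  simp [Fin.snoc_castSucc, Fin.snoc_last]

theorem lintegral_historyLaw_succ (arms : ActionSets M K d) (π : Policy M K) (p : PMF (Fin M))
    (θ : EuclideanSpace ℝ (Fin d)) (n t : ℕ) {f : History M K (t + 1) → ℝ≥0∞}
    (hf : Measurable f) :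
    ∫⁻ h, f h ∂historyLaw arms π p θ n (t + 1) =
      ∫⁻ h, ∫⁻ r, f (Fin.snoc h r) ∂roundKernel arms π p θ n t h ∂historyLaw arms π p θ n t := by
  rw [historyLaw, lintegral_map hf (measurable_snoc t)]
  exact Measure.lintegral_compProd (hf.comp (measurable_snoc t))

theorem lintegral_roundKernel (arms : ActionSets M K d) (π : Policy M K) (p : PMF (Fin M))
    (θ : EuclideanSpace ℝ (Fin d)) (n t : ℕ) (h : History M K t) {f : Round M K → ℝ≥0∞}
    (hf : Measurable f) :
    ∫⁻ r, f r ∂roundKernel arms π p θ n t h =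
      ∫⁻ z, ∫⁻ y, f (z, y) ∂gaussianReal (armInner arms θ z) 1
        ∂(Kernel.const (History M K t) p.toMeasure ⊗ₖ π.select n t) h := by
  rw [roundKernel, Kernel.lintegral_compProd _ _ _ hf]
  rfl

/-- Changing the parameter multiplies the law of a round by the Gaussian likelihood ratio. -/
theorem lintegral_roundKernel_add (arms : ActionSets M K d) (π : Policy M K) (p : PMF (Fin M))
    (θ v : EuclideanSpace ℝ (Fin d)) (n t : ℕ) (h : History M K t) {f : Round M K → ℝ≥0∞}
    (hf : Measurable f) :
    ∫⁻ r, f r ∂roundKernel arms π p (θ + v) n t h =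
      ∫⁻ r, ENNReal.ofReal (Real.exp (logRatio arms θ v r)) * f r
        ∂roundKernel arms π p θ n t h := by
  rw [lintegral_roundKernel _ _ _ _ _ _ _ hf, lintegral_roundKernel _ _ _ _ _ _ _ (by fun_prop)]
  refine lintegral_congr fun z => ?_
  rw [armInner_add, gaussianReal_add_eq_withDensity,
    lintegral_withDensity_eq_lintegral_mul _ (by fun_prop) (by fun_prop)]
  rfl

@[fun_prop]
theorem measurable_sum_logRatio (arms : ActionSets M K d) (θ v : EuclideanSpace ℝ (Fin d))
    (t : ℕ) : Measurable (fun h : History M K t => ∑ i, logRatio arms θ v (h i)) :=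
  Finset.measurable_sum _ fun i _ => (measurable_logRatio arms θ v).comp (measurable_pi_apply i)

/-- Likelihood ratio of histories: the contributions of the contexts and of the policy cancel, so
only the rewards enter. -/
theorem historyLaw_add_eq_withDensity (arms : ActionSets M K d) (π : Policy M K)
    (p : PMF (Fin M)) (θ v : EuclideanSpace ℝ (Fin d)) (n t : ℕ) :
    historyLaw arms π p (θ + v) n t = (historyLaw arms π p θ n t).withDensity
      (fun h => ENNReal.ofReal (Real.exp (∑ i, logRatio arms θ v (h i)))) := by
  induction t with
  | zero => simp [historyLaw]
  | succ t ih =>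
    refine Measure.ext_of_lintegral _ fun f hf => ?_
    have hm := measurable_snoc (M := M) (K := K) t
    have hS : ∀ h : History M K t, Measurable (fun r : Round M K => f (Fin.snoc h r)) := fun h =>
      (hf.comp hm).comp measurable_prodMk_left
    have hF : Measurable (fun x : History M K t × Round M K =>
        ENNReal.ofReal (Real.exp (logRatio arms θ v x.2)) * f (Fin.snoc x.1 x.2)) := by
      have := hf.comp hm
      simp only [Function.comp_def] at this
      fun_prop
    have hL : Measurable (fun h : History M K t =>
        ∫⁻ r, f (Fin.snoc h r) ∂roundKernel arms π p (θ + v) n t h) :=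
      (hf.comp hm).lintegral_kernel_prod_right'
    rw [lintegral_historyLaw_succ _ _ _ _ _ _ hf, ih,
      lintegral_withDensity_eq_lintegral_mul _ (by fun_prop) hL,
      lintegral_withDensity_eq_lintegral_mul _ (by fun_prop) hf,
      lintegral_historyLaw_succ _ _ _ _ _ _ (by fun_prop)]
    refine lintegral_congr fun h => ?_
    simp only [Pi.mul_apply]
    rw [lintegral_roundKernel_add _ _ _ _ _ _ _ _ (hS h), ← lintegral_const_mul]
    · refine lintegral_congr fun r => ?_
      rw [sum_snoc, Real.exp_add, ENNReal.ofReal_mul (Real.exp_nonneg _), mul_assoc]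
    · exact Measurable.of_uncurry_left (f := fun h r =>
        ENNReal.ofReal (Real.exp (logRatio arms θ v r)) * f (Fin.snoc h r)) hF

/-! ### Moments of the noise, regret and divergence -/

theorem integral_historyLaw_succ (arms : ActionSets M K d) (π : Policy M K) (p : PMF (Fin M))
    (θ : EuclideanSpace ℝ (Fin d)) (n t : ℕ) {f : History M K (t + 1) → ℝ}
    (hf : Integrable f (historyLaw arms π p θ n (t + 1))) :
    ∫ h, f h ∂historyLaw arms π p θ n (t + 1) =
      ∫ h, ∫ r, f (Fin.snoc h r) ∂roundKernel arms π p θ n t h ∂historyLaw arms π p θ n t := by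
  have hm := measurable_snoc (M := M) (K := K) t
  rw [historyLaw] at hf ⊢
  rw [integral_map hm.aemeasurable hf.1]
  exact Measure.integral_compProd ((integrable_map_measure hf.1 hm.aemeasurable).1 hf)

theorem measurable_noise (arms : ActionSets M K d) (θ : EuclideanSpace ℝ (Fin d))
    (b : Fin M × Fin K → ℝ) :
    Measurable (fun r : Round M K => b r.1 * (r.2 - armInner arms θ r.1)) := by
  have h1 := measurable_comp_fst b
  have h2 := measurable_comp_fst (armInner arms θ)
  fun_prop

theorem integrable_gaussianReal_centered (μ b : ℝ) :
    Integrable (fun y => b * (y - μ)) (gaussianReal μ 1) :=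
  (((memLp_id_gaussianReal (μ := μ) (v := 1) 1).integrable (by simp)).sub
    (integrable_const μ)).const_mul b

theorem integral_gaussianReal_centered (μ b : ℝ) :
    ∫ y, b * (y - μ) ∂gaussianReal μ 1 = 0 := by
  have hi : Integrable (fun y : ℝ => y) (gaussianReal μ 1) :=
    (memLp_id_gaussianReal (μ := μ) (v := 1) 1).integrable (by simp)
  rw [integral_const_mul, integral_sub hi (integrable_const μ), integral_id_gaussianReal]
  simp

theorem integrable_roundKernel_noise (arms : ActionSets M K d) (π : Policy M K)
    (p : PMF (Fin M)) (θ : EuclideanSpace ℝ (Fin d)) (n t : ℕ) (b : Fin M × Fin K → ℝ)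
    (h : History M K t) :
    Integrable (fun r : Round M K => b r.1 * (r.2 - armInner arms θ r.1))
      (roundKernel arms π p θ n t h) := by
  rw [roundKernel, ProbabilityTheory.integrable_compProd_iff
    (measurable_noise arms θ b).aestronglyMeasurable]
  exact ⟨ae_of_all _ fun z => integrable_gaussianReal_centered (armInner arms θ z) (b z),
    Integrable.of_finite⟩

theorem integral_roundKernel_noise (arms : ActionSets M K d) (π : Policy M K)
    (p : PMF (Fin M)) (θ : EuclideanSpace ℝ (Fin d)) (n t : ℕ) (b : Fin M × Fin K → ℝ)
    (h : History M K t) :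
    ∫ r, b r.1 * (r.2 - armInner arms θ r.1) ∂roundKernel arms π p θ n t h = 0 := by
  have hi := integrable_roundKernel_noise arms π p θ n t b h
  rw [roundKernel] at hi ⊢
  rw [ProbabilityTheory.integral_compProd hi]
  exact integral_eq_zero_of_ae (ae_of_all _ fun z =>
    integral_gaussianReal_centered (armInner arms θ z) (b z))

/-- The conditional first absolute moment of the noise of a round is bounded uniformly in the
past. -/
theorem integral_norm_roundKernel_noise_le (arms : ActionSets M K d) (π : Policy M K)
    (p : PMF (Fin M)) (θ : EuclideanSpace ℝ (Fin d)) (n t : ℕ) (b : Fin M × Fin K → ℝ)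
    (h : History M K t) :
    ∫ r, ‖b r.1 * (r.2 - armInner arms θ r.1)‖ ∂roundKernel arms π p θ n t h ≤
      ∑ z, ∫ y, ‖b z * (y - armInner arms θ z)‖ ∂gaussianReal (armInner arms θ z) 1 := by
  have hi := (integrable_roundKernel_noise arms π p θ n t b h).norm
  have hnn : ∀ z ∈ Finset.univ,
      0 ≤ ∫ y, ‖b z * (y - armInner arms θ z)‖ ∂gaussianReal (armInner arms θ z) 1 :=
    fun z _ => integral_nonneg fun y => norm_nonneg _
  rw [roundKernel] at hi ⊢
  rw [ProbabilityTheory.integral_compProd hi]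
  calc _ ≤ ∫ _z, (∑ z, ∫ y, ‖b z * (y - armInner arms θ z)‖ ∂gaussianReal (armInner arms θ z) 1)
        ∂(Kernel.const (History M K t) p.toMeasure ⊗ₖ π.select n t) h :=
        integral_mono Integrable.of_finite Integrable.of_finite fun z =>
          Finset.single_le_sum hnn (Finset.mem_univ z)
    _ = _ := by simp

/-- The accumulated noise, weighted by a function of context and arm, is a centered integrable
variable: it is a martingale in the number of rounds. -/
theorem integral_sum_noise (arms : ActionSets M K d) (π : Policy M K) (p : PMF (Fin M))
    (θ : EuclideanSpace ℝ (Fin d)) (n : ℕ) (b : Fin M × Fin K → ℝ) (t : ℕ) :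
    Integrable (fun h : History M K t => ∑ i, b (h i).1 * ((h i).2 - armInner arms θ (h i).1))
      (historyLaw arms π p θ n t) ∧
    ∫ h, ∑ i, b (h i).1 * ((h i).2 - armInner arms θ (h i).1) ∂historyLaw arms π p θ n t = 0 := by
  induction t with
  | zero => simp
  | succ t ih =>
    have hm := measurable_snoc (M := M) (K := K) t
    set g : Round M K → ℝ := fun r => b r.1 * (r.2 - armInner arms θ r.1) with hg
    have hgm : Measurable g := measurable_noise arms θ b
    have hsm : Measurable (fun h : History M K (t + 1) => ∑ i, g (h i)) :=
      Finset.measurable_sum _ fun i _ => hgm.comp (measurable_pi_apply i)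
    have hlast : Integrable (fun z : History M K t × Round M K => g z.2)
        (historyLaw arms π p θ n t ⊗ₘ roundKernel arms π p θ n t) := by
      have hgs : Measurable (fun z : History M K t × Round M K => g z.2) :=
        hgm.comp measurable_snd
      rw [Measure.integrable_compProd_iff hgs.aestronglyMeasurable]
      refine ⟨ae_of_all _ fun h => integrable_roundKernel_noise arms π p θ n t b h, ?_⟩
      refine Integrable.of_bound ?_
        (∑ z, ∫ y, ‖b z * (y - armInner arms θ z)‖ ∂gaussianReal (armInner arms θ z) 1)
        (ae_of_all _ fun h => ?_)
      · exact (StronglyMeasurable.integral_kernel_prod_right'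
          (κ := roundKernel arms π p θ n t) (f := fun z : History M K t × Round M K => ‖g z.2‖)
          (hgm.comp measurable_snd).norm.stronglyMeasurable).aestronglyMeasurable
      · rw [Real.norm_of_nonneg (integral_nonneg fun y => norm_nonneg _)]
        exact integral_norm_roundKernel_noise_le arms π p θ n t b h
    have hfirst : Integrable (fun z : History M K t × Round M K => ∑ i, g (z.1 i))
        (historyLaw arms π p θ n t ⊗ₘ roundKernel arms π p θ n t) := by
      have h1 := ih.1
      rw [← Measure.fst_compProd (historyLaw arms π p θ n t) (roundKernel arms π p θ n t)] at h1
      exact h1.comp_measurable measurable_fst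
    have hint : Integrable (fun h : History M K (t + 1) => ∑ i, g (h i))
        (historyLaw arms π p θ n (t + 1)) := by
      rw [historyLaw, integrable_map_measure hsm.aestronglyMeasurable hm.aemeasurable]
      refine (hfirst.add hlast).congr (ae_of_all _ fun z => ?_)
      exact (sum_snoc g z.1 z.2).symm
    refine ⟨hint, ?_⟩
    rw [integral_historyLaw_succ _ _ _ _ _ _ hint, ← ih.2]
    refine integral_congr_ae (ae_of_all _ fun h => ?_)
    simp only [sum_snoc]
    rw [integral_add (integrable_const _) (integrable_roundKernel_noise arms π p θ n t b h),
      integral_roundKernel_noise]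
    simp [hg]

/-- The regret is the sum of the gaps weighted by the expected numbers of pulls. -/
theorem regret_eq_sum (arms : ActionSets M K d) (π : Policy M K) (p : PMF (Fin M))
    (θ : EuclideanSpace ℝ (Fin d)) (n : ℕ) :
    regret arms π p θ n = ∑ z : Fin M × Fin K, gap arms θ z.1 z.2 * expPulls arms π p θ n n z := by
  have h1 := integral_sum_noise arms π p θ n (fun _ => 1) n
  have h2 := integral_sum_rounds arms π p θ n n (fun z => gap arms θ z.1 z.2)
  rw [← h2.2, ← sub_zero (∫ h, _ ∂_), ← h1.2, ← integral_sub h2.1 h1.1]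
  refine integral_congr_ae (ae_of_all _ fun h => ?_)
  simp only [← Finset.sum_sub_distrib]
  refine Finset.sum_congr rfl fun i _ => ?_
  simp only [gap, armInner]
  ring

/-- Divergence decomposition: the relative entropy of the two laws of the history is the sum of the
Gaussian divergences of the arms weighted by the expected numbers of pulls. -/
theorem integral_sum_logRatio (arms : ActionSets M K d) (π : Policy M K) (p : PMF (Fin M))
    (θ v : EuclideanSpace ℝ (Fin d)) (n t : ℕ) :
    Integrable (fun h : History M K t => ∑ i, logRatio arms θ v (h i))
      (historyLaw arms π p θ n t) ∧
    ∫ h, ∑ i, logRatio arms θ v (h i) ∂historyLaw arms π p θ n t =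
      -(∑ z, armInner arms v z ^ 2 * expPulls arms π p θ n t z) / 2 := by
  have h1 := integral_sum_noise arms π p θ n (armInner arms v) t
  have h2 := integral_sum_rounds arms π p θ n t (fun z => armInner arms v z ^ 2)
  simp only [logRatio, Finset.sum_sub_distrib, ← Finset.sum_div]
  refine ⟨h1.1.sub (h2.1.div_const 2), ?_⟩
  rw [integral_sub h1.1 (h2.1.div_const 2), h1.2, integral_div, h2.2]
  ring

/-! ### Visits of a context -/

theorem integral_roundKernel_context (arms : ActionSets M K d) (π : Policy M K)
    (p : PMF (Fin M)) (θ : EuclideanSpace ℝ (Fin d)) (n t : ℕ) (h : History M K t) (m : Fin M) :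
    ∫ r, (if r.1.1 = m then 1 else 0 : ℝ) ∂roundKernel arms π p θ n t h = (p m).toReal := by
  have h1 : (fun r : Round M K => (if r.1.1 = m then 1 else 0 : ℝ)) =
      (Prod.fst ⁻¹' (Prod.fst ⁻¹' {m}) : Set (Round M K)).indicator 1 := by
    funext r
    simp [Set.indicator]
  have hs : MeasurableSet (Prod.fst ⁻¹' {m} : Set (Fin M × Fin K)) := MeasurableSet.of_discrete
  rw [h1, integral_indicator_one (measurable_fst hs), measureReal_def,
    ← Measure.map_apply measurable_fst hs, ← Kernel.fst_apply, roundKernel, Kernel.fst_compProd,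
    ← Measure.map_apply measurable_fst (MeasurableSet.of_discrete), ← Kernel.fst_apply,
    Kernel.fst_compProd, Kernel.const_apply,
    PMF.toMeasure_apply_singleton _ _ (MeasurableSet.of_discrete)]

/-- The number of rounds of `h` in which the context is `m`. -/
noncomputable def visits {t : ℕ} (m : Fin M) (h : History M K t) : ℝ :=
  ∑ i, if (h i).1.1 = m then 1 else 0

theorem visits_eq_sum_pulls {t : ℕ} (m : Fin M) (h : History M K t) :
    visits m h = ∑ k, pulls (m, k) h := by
  simp only [visits, pulls]
  rw [Finset.sum_comm]
  refine Finset.sum_congr rfl fun i _ => ?_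
  by_cases hm : (h i).1.1 = m
  · simp [Prod.ext_iff, hm]
  · simp [Prod.ext_iff, hm]

theorem measurable_visits {t : ℕ} (m : Fin M) :
    Measurable (visits m : History M K t → ℝ) := by
  simp only [funext (visits_eq_sum_pulls m)]
  exact Finset.measurable_sum _ fun k _ => measurable_pulls _

theorem visits_nonneg {t : ℕ} (m : Fin M) (h : History M K t) : 0 ≤ visits m h :=
  Finset.sum_nonneg fun i _ => by split_ifs <;> simp

theorem visits_le {t : ℕ} (m : Fin M) (h : History M K t) : visits m h ≤ t := by
  calc visits m h ≤ ∑ _i : Fin t, (1 : ℝ) := Finset.sum_le_sum fun i _ => by split_ifs <;> simp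
    _ = t := by simp

theorem integrable_visits_sub_sq (arms : ActionSets M K d) (π : Policy M K) (p : PMF (Fin M))
    (θ : EuclideanSpace ℝ (Fin d)) (n t : ℕ) (m : Fin M) (c : ℝ) :
    Integrable (fun h => (visits m h - c) ^ 2) (historyLaw arms π p θ n t) := by
  have hm := measurable_visits (K := K) (t := t) m
  refine Integrable.of_bound (by fun_prop) ((t + |c|) ^ 2) (ae_of_all _ fun h => ?_)
  rw [Real.norm_of_nonneg (sq_nonneg _)]
  refine sq_le_sq' ?_ ?_
  · linarith [visits_nonneg m h, le_abs_self c, (Nat.cast_nonneg t : (0 : ℝ) ≤ t)]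
  · linarith [visits_le m h, neg_abs_le c]

theorem visits_snoc {t : ℕ} (m : Fin M) (h : History M K t) (r : Round M K) :
    visits m (Fin.snoc h r : History M K (t + 1)) =
      visits m h + if r.1.1 = m then 1 else 0 :=
  sum_snoc (fun r => if r.1.1 = m then 1 else 0) h r

/-- The number of visits of a context is binomial; this is its variance. -/
theorem integral_visits_sub_sq (arms : ActionSets M K d) (π : Policy M K) (p : PMF (Fin M))
    (θ : EuclideanSpace ℝ (Fin d)) (n t : ℕ) (m : Fin M) :
    ∫ h, (visits m h - t * (p m).toReal) ^ 2 ∂historyLaw arms π p θ n t =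
      t * ((p m).toReal * (1 - (p m).toReal)) := by
  induction t with
  | zero => simp [visits]
  | succ t ih =>
    set q := (p m).toReal with hq
    rw [integral_historyLaw_succ _ _ _ _ _ _ (integrable_visits_sub_sq arms π p θ n (t + 1) m _)]
    have hi : ∀ h : History M K t,
        ∫ r, (visits m (Fin.snoc h r : History M K (t + 1)) - (t + 1 : ℕ) * q) ^ 2
        ∂roundKernel arms π p θ n t h = (visits m h - t * q) ^ 2 + q * (1 - q) := fun h => by
      have h1 : Integrable (fun r : Round M K => (if r.1.1 = m then 1 else 0 : ℝ))
        (roundKernel arms π p θ n t h) := by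
        refine Integrable.of_bound (C := 1) (measurable_comp_fst
          (fun z : Fin M × Fin K => if z.1 = m then (1 : ℝ) else 0)).aestronglyMeasurable
          (ae_of_all _ fun r => ?_)
        split_ifs <;> simp
      have h2 : ∀ r : Round M K,
          (visits m (Fin.snoc h r : History M K (t + 1)) - (t + 1 : ℕ) * q) ^ 2 =
          (visits m h - (t + 1) * q) ^ 2 + (2 * (visits m h - (t + 1) * q) + 1) *
            (if r.1.1 = m then 1 else 0) := fun r => by
        rw [visits_snoc]
        push_cast
        split_ifs <;> ring
      simp only [h2]
      rw [integral_add (integrable_const _) (h1.const_mul _), integral_const_mul,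
        integral_roundKernel_context, ← hq]
      simp
      ring
    simp only [hi]
    rw [integral_add (integrable_visits_sub_sq arms π p θ n t m _) (integrable_const _), ih]
    simp
    ring

/-! ### Testing inequality -/

theorem integrable_exp_sum_logRatio (arms : ActionSets M K d) (π : Policy M K) (p : PMF (Fin M))
    (θ v : EuclideanSpace ℝ (Fin d)) (n t : ℕ) :
    Integrable (fun h : History M K t => Real.exp (∑ i, logRatio arms θ v (h i)))
      (historyLaw arms π p θ n t) := by
  have h1 : ∫⁻ h, ENNReal.ofReal (Real.exp (∑ i, logRatio arms θ v (h i)))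
      ∂historyLaw arms π p θ n t = 1 := by
    rw [← setLIntegral_univ, ← withDensity_apply _ MeasurableSet.univ,
      ← historyLaw_add_eq_withDensity]
    exact measure_univ
  refine (integrable_toReal_of_lintegral_ne_top
    (measurable_sum_logRatio arms θ v t).exp.ennreal_ofReal.aemeasurable
    (h1.trans_ne ENNReal.one_ne_top)).congr (ae_of_all _ fun h => ?_)
  exact ENNReal.toReal_ofReal (Real.exp_nonneg _)

theorem integral_exp_sum_logRatio_mul (arms : ActionSets M K d) (π : Policy M K)
    (p : PMF (Fin M)) (θ v : EuclideanSpace ℝ (Fin d)) (n t : ℕ) (f : History M K t → ℝ) :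
    ∫ h, Real.exp (∑ i, logRatio arms θ v (h i)) * f h ∂historyLaw arms π p θ n t =
      ∫ h, f h ∂historyLaw arms π p (θ + v) n t := by
  rw [historyLaw_add_eq_withDensity, integral_withDensity_eq_integral_toReal_smul (by fun_prop)
    (ae_of_all _ fun h => ENNReal.ofReal_lt_top)]
  refine integral_congr_ae (ae_of_all _ fun h => ?_)
  simp [ENNReal.toReal_ofReal (Real.exp_nonneg _)]

/-- Pointwise form of the testing inequality: if the weights `v` and `b` add up to at least one,
the square root `x` of the likelihood ratio is split between them. -/
theorem le_of_one_le_add {x v b δ : ℝ} (hx : 0 ≤ x) (hv : 0 ≤ v) (hb : 0 ≤ b) (hδ : 0 < δ)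
    (h : 1 ≤ v + b) :
    x ≤ δ / 2 * x ^ 2 + δ / 2 + v / (2 * δ) + x ^ 2 * b / (2 * δ) := by
  obtain ⟨s, hs, rfl⟩ : ∃ s, 0 ≤ s ∧ s ^ 2 = v := ⟨√v, Real.sqrt_nonneg v, Real.sq_sqrt hv⟩
  obtain ⟨r, hr, rfl⟩ : ∃ r, 0 ≤ r ∧ r ^ 2 = b := ⟨√b, Real.sqrt_nonneg b, Real.sq_sqrt hb⟩
  have h1 : 1 ≤ s + r := by nlinarith [mul_nonneg hs hr]
  have e : δ / 2 * x ^ 2 + δ / 2 + s ^ 2 / (2 * δ) + x ^ 2 * r ^ 2 / (2 * δ) - x * (s + r) =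
      ((δ * x - s) ^ 2 + (δ - x * r) ^ 2) / (2 * δ) := by
    field_simp
    ring
  have h2 : 0 ≤ ((δ * x - s) ^ 2 + (δ - x * r) ^ 2) / (2 * δ) := by positivity
  nlinarith [mul_le_mul_of_nonneg_left h1 hx]

/-- A Bretagnolle–Huber type inequality for the two laws of the history, with the events replaced
by the proportions of visits of the context `m` in which the arm `k` is, or is not, played. -/
theorem exp_neg_divergence_le (arms : ActionSets M K d) (π : Policy M K) (p : PMF (Fin M))
    (θ v : EuclideanSpace ℝ (Fin d)) {n : ℕ} (hn : 0 < n) (m : Fin M) (hm : 0 < (p m).toReal)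
    (k : Fin K) {δ : ℝ} (hδ : 0 < δ) :
    Real.exp (-(∑ z, armInner arms v z ^ 2 * expPulls arms π p θ n n z) / 4) ≤
      δ + (1 + 2 * (∑ j ∈ Finset.univ.erase k, expPulls arms π p θ n n (m, j)) +
        2 * expPulls arms π p (θ + v) n n (m, k)) / (2 * δ * (n * (p m).toReal)) := by
  set q := (p m).toReal with hq
  have hn' : (0 : ℝ) < n := Nat.cast_pos.2 hn
  set c := n * q with hc
  have hc0 : 0 < c := by positivity
  set P := historyLaw arms π p θ n n with hP
  set S : History M K n → ℝ := fun h => ∑ i, logRatio arms θ v (h i) with hS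
  have hSi := integral_sum_logRatio arms π p θ v n n
  have hL := integrable_exp_sum_logRatio arms π p θ v n n
  set V : History M K n → ℝ := fun h => ((visits m h - c) / c) ^ 2 +
    2 / c * ∑ j ∈ Finset.univ.erase k, pulls (m, j) h with hV
  set B : History M K n → ℝ := fun h => 2 / c * pulls (m, k) h with hB
  -- With `u = visits m h / c`, the sum is `(u - 1) ^ 2 + 2 * u = 1 + u ^ 2`.
  have hVB : ∀ h, 1 ≤ V h + B h := fun h => by
    have e : visits m h = pulls (m, k) h + ∑ j ∈ Finset.univ.erase k, pulls (m, j) h := by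
      rw [visits_eq_sum_pulls, 
        Finset.add_sum_erase _ (fun j => pulls (m, j) h) (Finset.mem_univ k)]
    have : V h + B h = 1 + (visits m h / c) ^ 2 := by
      simp only [hV, hB]
      rw [add_assoc, ← mul_add, add_comm (∑ j ∈ _, _), ← e]
      field_simp
      ring
    rw [this]
    nlinarith [sq_nonneg (visits m h / c)]
  have hV0 : ∀ h, 0 ≤ V h := fun h => by
    have : 0 ≤ ∑ j ∈ Finset.univ.erase k, pulls (m, j) h :=
      Finset.sum_nonneg fun j _ => pulls_nonneg _ _
    positivity
  have hB0 : ∀ h, 0 ≤ B h := fun h => by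
    have := pulls_nonneg (m, k) h
    positivity
  have hBm : Measurable B := (measurable_pulls (m, k)).const_mul _
  have hV1 : Integrable (fun h => ((visits m h - c) / c) ^ 2) P := by
    simp only [div_pow]
    exact (integrable_visits_sub_sq arms π p θ n n m c).div_const _
  have hV2 : Integrable (fun h => ∑ j ∈ Finset.univ.erase k, pulls (m, j) h) P :=
    integrable_finsetSum _ fun j _ => integrable_pulls arms π p θ n n (m, j)
  have hVi : Integrable V P := hV1.add (hV2.const_mul _)
  have hVint : ∫ h, V h ∂P ≤
      1 / c + 2 / c * ∑ j ∈ Finset.univ.erase k, expPulls arms π p θ n n (m, j) := by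
    simp only [hV]
    rw [integral_add hV1 (hV2.const_mul _), integral_const_mul,
      integral_finsetSum _ fun j _ => integrable_pulls arms π p θ n n (m, j)]
    refine add_le_add ?_ le_rfl
    simp only [div_pow]
    rw [integral_div, hP, integral_visits_sub_sq, ← hq, div_le_div_iff₀ (by positivity) hc0]
    have : 0 ≤ c ^ 2 * q := by positivity
    calc n * (q * (1 - q)) * c = c ^ 2 - c ^ 2 * q := by rw [hc]; ring
      _ ≤ 1 * c ^ 2 := by linarith
  have hLB : Integrable (fun h => Real.exp (S h) * B h) P := by
    refine hL.mul_bdd (c := 2 / c * n) hBm.aestronglyMeasurable (ae_of_all _ fun h => ?_)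
    rw [Real.norm_of_nonneg (hB0 h)]
    exact mul_le_mul_of_nonneg_left (pulls_le _ h) (by positivity)
  have hL1 : ∫ h, Real.exp (S h) ∂P = 1 := by
    have := integral_exp_sum_logRatio_mul arms π p θ v n n (fun _ => 1)
    simpa using this
  have hLB1 : ∫ h, Real.exp (S h) * B h ∂P = 2 / c * expPulls arms π p (θ + v) n n (m, k) := by
    rw [integral_exp_sum_logRatio_mul, integral_const_mul]
    rfl
  have hpt : ∀ h, Real.exp (S h / 2) ≤ δ / 2 * Real.exp (S h) + δ / 2 + V h / (2 * δ) +
      Real.exp (S h) * B h / (2 * δ) := fun h => by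
    have e : Real.exp (S h / 2) ^ 2 = Real.exp (S h) := by
      rw [← Real.exp_nat_mul]; congr 1; push_cast; ring
    have := le_of_one_le_add (Real.exp_nonneg (S h / 2)) (hV0 h) (hB0 h) hδ (hVB h)
    rwa [e] at this
  have hXm : Measurable (fun h => Real.exp (S h / 2)) := by fun_prop
  have i1 : Integrable (fun h => δ / 2 * Real.exp (S h)) P := hL.const_mul _
  have i2 : Integrable (fun h => δ / 2 * Real.exp (S h) + δ / 2) P := i1.add (integrable_const _)
  have i3 : Integrable (fun h => δ / 2 * Real.exp (S h) + δ / 2 + V h / (2 * δ)) P :=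
    i2.add (hVi.div_const (2 * δ))
  have i4 : Integrable (fun h => δ / 2 * Real.exp (S h) + δ / 2 + V h / (2 * δ) +
      Real.exp (S h) * B h / (2 * δ)) P := i3.add (hLB.div_const (2 * δ))
  have hXi : Integrable (fun h => Real.exp (S h / 2)) P := by
    refine i4.mono' hXm.aestronglyMeasurable (ae_of_all _ fun h => ?_)
    rw [Real.norm_of_nonneg (Real.exp_nonneg _)]
    exact hpt h
  have hJ : Real.exp (∫ h, S h / 2 ∂P) ≤ ∫ h, Real.exp (S h / 2) ∂P :=
    convexOn_exp.map_integral_le Real.continuous_exp.continuousOn isClosed_univ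
      (ae_of_all _ fun _ => Set.mem_univ _) (hSi.1.div_const 2) hXi
  rw [integral_div, hSi.2] at hJ
  calc _ = Real.exp (-(∑ z, armInner arms v z ^ 2 * expPulls arms π p θ n n z) / 2 / 2) := by
        congr 1; ring
    _ ≤ ∫ h, Real.exp (S h / 2) ∂P := hJ
    _ ≤ ∫ h, (δ / 2 * Real.exp (S h) + δ / 2 + V h / (2 * δ) +
      Real.exp (S h) * B h / (2 * δ)) ∂P := integral_mono hXi i4 hpt
    _ = δ + (∫ h, V h ∂P) / (2 * δ) +
        2 / c * expPulls arms π p (θ + v) n n (m, k) / (2 * δ) := by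
      rw [integral_add i3 (hLB.div_const _), integral_add i2 (hVi.div_const _),
        integral_add i1 (integrable_const _), integral_const_mul, integral_div (2 * δ),
        integral_div (2 * δ), hL1, hLB1]
      simp
    _ ≤ δ + (1 / c + 2 / c * ∑ j ∈ Finset.univ.erase k, expPulls arms π p θ n n (m, j)) / (2 * δ) +
        2 / c * expPulls arms π p (θ + v) n n (m, k) / (2 * δ) := by gcongr
    _ = _ := by field_simp; ring

/-! ### Information collected by a consistent policy -/

theorem gap_nonneg (arms : ActionSets M K d) (θ : EuclideanSpace ℝ (Fin d)) (m : Fin M)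
    (k : Fin K) : 0 ≤ gap arms θ m k :=
  sub_nonneg.2 (le_ciSup (f := fun k => inner ℝ (arms m k) θ) (Set.finite_range _).bddAbove k)

theorem inner_sub_inner_le_gap (arms : ActionSets M K d) (θ : EuclideanSpace ℝ (Fin d))
    (m : Fin M) (j k : Fin K) : inner ℝ (arms m j) θ - inner ℝ (arms m k) θ ≤ gap arms θ m k :=
  sub_le_sub_right
    (le_ciSup (f := fun k => inner ℝ (arms m k) θ) (Set.finite_range _).bddAbove j) _

theorem gap_mul_expPulls_le_regret (arms : ActionSets M K d) (π : Policy M K) (p : PMF (Fin M))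
    (θ : EuclideanSpace ℝ (Fin d)) (n : ℕ) (z : Fin M × Fin K) :
    gap arms θ z.1 z.2 * expPulls arms π p θ n n z ≤ regret arms π p θ n := by
  rw [regret_eq_sum]
  exact Finset.single_le_sum
    (f := fun z : Fin M × Fin K => gap arms θ z.1 z.2 * expPulls arms π p θ n n z)
    (fun z _ => mul_nonneg (gap_nonneg _ _ _ _) (expPulls_nonneg _ _ _ _ _ _ _))
    (Finset.mem_univ z)

/-- The information that a consistent policy must collect: if `k` is the only optimal arm of
context `m` under `θ` and is suboptimal under `θ + v`, then the relative entropy between the two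
laws of the history is at least `(1 - o(1)) log n`. -/
theorem eventually_log_le_divergence (arms : ActionSets M K d) (π : Policy M K)
    (hπ : IsConsistent arms π) (p : PMF (Fin M)) (hp : ∀ m, 0 < p m)
    (θ v : EuclideanSpace ℝ (Fin d)) (m : Fin M) (k : Fin K)
    (hgap : ∀ j, j ≠ k → 0 < gap arms θ m j) (hgap' : 0 < gap arms (θ + v) m k)
    {ε : ℝ} (hε : 0 < ε) :
    ∀ᶠ n : ℕ in atTop, (1 - ε) * Real.log n ≤
      (∑ z, armInner arms v z ^ 2 * expPulls arms π p θ n n z) / 2 := by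
  have hq : 0 < (p m).toReal := ENNReal.toReal_pos (hp m).ne' (p.apply_ne_top m)
  set q := (p m).toReal with hq'
  set A : ℝ := ∑ j ∈ Finset.univ.erase k, (gap arms θ m j)⁻¹ with hA
  have hA0 : 0 ≤ A := Finset.sum_nonneg fun j _ => inv_nonneg.2 (gap_nonneg _ _ _ _)
  set A' : ℝ := (gap arms (θ + v) m k)⁻¹ with hA'
  have hA'0 : 0 < A' := inv_pos.2 hgap'
  set C : ℝ := 1 + (1 + 2 * A + 2 * A') / (2 * q) with hC
  have hC0 : 0 < C := by positivity
  have hlog : Tendsto (fun n : ℕ => Real.log n) atTop atTop :=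
    Real.tendsto_log_atTop.comp tendsto_natCast_atTop_atTop
  have b1 := (hπ p hp θ (ε / 2) (by positivity)).bound one_pos
  have b2 := (hπ p hp (θ + v) (ε / 2) (by positivity)).bound one_pos
  filter_upwards [b1, b2, eventually_gt_atTop 0, hlog.eventually_ge_atTop (4 * Real.log C / ε)]
    with n h1 h2 hn hln
  have hn' : (0 : ℝ) < n := Nat.cast_pos.2 hn
  have hn1 : (1 : ℝ) ≤ n := by exact_mod_cast hn
  have hpow : 1 ≤ (n : ℝ) ^ (ε / 2) := Real.one_le_rpow hn1 (by positivity)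
  rw [one_mul, Real.norm_of_nonneg (by positivity : 0 ≤ (n : ℝ) ^ (ε / 2))] at h1 h2
  replace h1 := (le_abs_self _).trans h1
  replace h2 := (le_abs_self _).trans h2
  set D := ∑ z, armInner arms v z ^ 2 * expPulls arms π p θ n n z with hD
  set w := (n : ℝ) ^ (ε / 2) with hw
  -- The choice of `δ` balances the two terms of the testing inequality.
  set δ := (n : ℝ) ^ ((ε / 2 - 1) / 2) with hδ
  have hδ0 : 0 < δ := by positivity
  have hδ2 : δ * δ * n = w := by
    rw [hδ, hw, ← Real.rpow_add hn']
    nth_rewrite 2 [← Real.rpow_one (n : ℝ)]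
    rw [← Real.rpow_add hn']
    congr 1
    ring
  have hT : ∑ j ∈ Finset.univ.erase k, expPulls arms π p θ n n (m, j) ≤ A * w := by
    rw [hA, Finset.sum_mul]
    refine Finset.sum_le_sum fun j hj => ?_
    have hg := hgap j (Finset.ne_of_mem_erase hj)
    rw [← div_eq_inv_mul, le_div_iff₀ hg, mul_comm]
    exact (gap_mul_expPulls_le_regret arms π p θ n (m, j)).trans h1
  have hT' : expPulls arms π p (θ + v) n n (m, k) ≤ A' * w := by
    rw [hA', ← div_eq_inv_mul, le_div_iff₀ hgap', mul_comm]
    exact (gap_mul_expPulls_le_regret arms π p (θ + v) n (m, k)).trans h2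
  have key := exp_neg_divergence_le arms π p θ v hn m hq k hδ0
  rw [← hD, ← hq'] at key
  have hle : Real.exp (-D / 4) ≤ C * δ := by
    refine key.trans ?_
    calc _ ≤ δ + (w + 2 * (A * w) + 2 * (A' * w)) / (2 * δ * (n * q)) := by gcongr
      _ = C * δ := by
        rw [hC, ← hδ2]
        field_simp
  have hlog2 := Real.log_le_log (Real.exp_pos _) hle
  rw [Real.log_exp, Real.log_mul hC0.ne' hδ0.ne', hδ, Real.log_rpow hn'] at hlog2
  rw [div_le_iff₀ hε] at hln
  nlinarith

/-! ### The allocation program -/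

theorem designMatrix_mulVec (arms : ActionSets M K d) (β : Fin M → Fin K → ℝ) (w : Fin d → ℝ) :
    (designMatrix arms β).mulVec w =
      ∑ m, ∑ k, (β m k * ((arms m k).ofLp ⬝ᵥ w)) • (arms m k).ofLp := by
  simp only [designMatrix, Matrix.sum_mulVec, Matrix.smul_mulVec, Matrix.vecMulVec_mulVec,
    mul_smul, op_smul_eq_smul]

theorem dotProduct_designMatrix_mulVec (arms : ActionSets M K d) (β : Fin M → Fin K → ℝ)
    (u w : Fin d → ℝ) : u ⬝ᵥ (designMatrix arms β).mulVec w =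
      ∑ m, ∑ k, β m k * ((arms m k).ofLp ⬝ᵥ u) * ((arms m k).ofLp ⬝ᵥ w) := by
  simp only [designMatrix_mulVec, dotProduct_sum, dotProduct_smul, smul_eq_mul]
  refine Finset.sum_congr rfl fun m _ => Finset.sum_congr rfl fun k _ => ?_
  rw [dotProduct_comm u]
  ring

theorem isHermitian_designMatrix (arms : ActionSets M K d) (β : Fin M → Fin K → ℝ) :
    (designMatrix arms β).IsHermitian := by
  simp only [designMatrix, Matrix.IsHermitian, Matrix.conjTranspose_sum,
    Matrix.conjTranspose_smul, Matrix.conjTranspose_vecMulVec, star_trivial]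

theorem isUnit_designMatrix (arms : ActionSets M K d) {β : Fin M → Fin K → ℝ}
    (hβ : ∀ m k, 0 ≤ β m k)
    (h : ∀ w : Fin d → ℝ, w ≠ 0 → ∃ m k, 0 < β m k ∧ (arms m k).ofLp ⬝ᵥ w ≠ 0) :
    IsUnit (designMatrix arms β) := by
  refine (Matrix.PosDef.of_dotProduct_mulVec_pos (isHermitian_designMatrix arms β)
    fun w hw => ?_).isUnit
  obtain ⟨m, k, hpos, hne⟩ := h w hw
  have hnn : ∀ m k, 0 ≤ β m k * ((arms m k).ofLp ⬝ᵥ w) * ((arms m k).ofLp ⬝ᵥ w) := fun m k => by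
    rw [mul_assoc]; exact mul_nonneg (hβ m k) (mul_self_nonneg _)
  rw [star_trivial, dotProduct_designMatrix_mulVec]
  refine Finset.sum_pos' (fun m _ => Finset.sum_nonneg fun k _ => hnn m k)
    ⟨m, Finset.mem_univ m, Finset.sum_pos' (fun k _ => hnn m k) ⟨k, Finset.mem_univ k, ?_⟩⟩
  rw [mul_assoc]
  exact mul_pos hpos (mul_self_pos.2 hne)

theorem truncate_nonneg (α : Fin M → Fin K → ℝ≥0∞) (N : ℕ) (m : Fin M) (k : Fin K) :
    0 ≤ truncate α N m k := ENNReal.toReal_nonneg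

theorem truncate_mono (α : Fin M → Fin K → ℝ≥0∞) {N N' : ℕ} (h : N ≤ N') (m : Fin M)
    (k : Fin K) : truncate α N m k ≤ truncate α N' m k :=
  ENNReal.toReal_mono (by simp) (min_le_min le_rfl (by exact_mod_cast h))

theorem truncate_pos {α : Fin M → Fin K → ℝ≥0∞} {N : ℕ} (hN : 0 < N) {m : Fin M}
    {k : Fin K} (h : α m k ≠ 0) : 0 < truncate α N m k := by
  refine ENNReal.toReal_pos (ne_of_gt ?_) (by simp)
  exact lt_min (pos_iff_ne_zero.2 h) (by exact_mod_cast hN)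

theorem truncate_of_eq_top {α : Fin M → Fin K → ℝ≥0∞} (N : ℕ) {m : Fin M} {k : Fin K}
    (h : α m k = ⊤) : truncate α N m k = N := by
  simp [truncate, h]

theorem eventually_toReal_le_truncate (α : Fin M → Fin K → ℝ≥0∞) :
    ∀ᶠ N : ℕ in atTop, ∀ m k, (α m k).toReal ≤ truncate α N m k := by
  simp only [eventually_all]
  intro m k
  filter_upwards [eventually_ge_atTop ⌈(α m k).toReal⌉₊] with N hN
  by_cases h : α m k = ⊤
  · simp [h, truncate_nonneg]
  · refine ENNReal.toReal_mono (by simp) (le_min le_rfl ?_)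
    rw [← ENNReal.ofReal_toReal h, ← ENNReal.ofReal_natCast]
    exact ENNReal.ofReal_le_ofReal ((Nat.le_ceil _).trans (by exact_mod_cast hN))

/-- Dual form of feasibility. The quadratic forms `xᵀ G⁻¹ x` decrease along the truncations. A limit
point `w` of the solutions of `G w = x` is orthogonal to the actions of infinite weight, and testing
the hypothesis with `w` bounds the limit. -/
theorem isFeasible_of_forall_sq_le (arms : ActionSets M K d) (θ : EuclideanSpace ℝ (Fin d))
    (α : Fin M → Fin K → ℝ≥0∞)
    (hα : ∀ w : Fin d → ℝ, w ≠ 0 → ∃ m k, α m k ≠ 0 ∧ (arms m k).ofLp ⬝ᵥ w ≠ 0)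
    (hdual : ∀ m k, 0 < gap arms θ m k → ∀ w : Fin d → ℝ,
      (∀ m' k', α m' k' = ⊤ → (arms m' k').ofLp ⬝ᵥ w = 0) →
      ((arms m k).ofLp ⬝ᵥ w) ^ 2 ≤ gap arms θ m k ^ 2 / 2 *
        ∑ m', ∑ k', (α m' k').toReal * ((arms m' k').ofLp ⬝ᵥ w) ^ 2) :
    IsFeasible arms θ α := by
  have hU : ∀ N : ℕ, 0 < N → IsUnit (designMatrix arms (truncate α N)) := fun N hN =>
    isUnit_designMatrix arms (truncate_nonneg α N) fun w hw => by
      obtain ⟨m, k, h1, h2⟩ := hα w hw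
      exact ⟨m, k, truncate_pos hN h1, h2⟩
  refine ⟨(eventually_gt_atTop 0).mono hU, fun m k hgap => ?_⟩
  set x := (arms m k).ofLp with hx
  set G : ℕ → Matrix (Fin d) (Fin d) ℝ := fun N => designMatrix arms (truncate α N) with hG
  set w : ℕ → Fin d → ℝ := fun N => (G N)⁻¹.mulVec x with hw
  set c : (Fin d → ℝ) → Fin M → Fin K → ℝ := fun u m k => (arms m k).ofLp ⬝ᵥ u with hc
  have hGw : ∀ N : ℕ, 0 < N → (G N).mulVec (w N) = x := fun N hN => by
    rw [hw, Matrix.mulVec_mulVec, Matrix.mul_nonsing_inv _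
      ((Matrix.isUnit_iff_isUnit_det _).1 (hU N hN)), Matrix.one_mulVec]
  have hform : ∀ N : ℕ, 0 < N → ∀ u, x ⬝ᵥ u = ∑ m, ∑ k, truncate α N m k * c u m k * c (w N) m k :=
    fun N hN u => by
      rw [← dotProduct_designMatrix_mulVec, dotProduct_comm]
      exact congrArg _ (hGw N hN).symm
  have hanti : ∀ N N' : ℕ, 0 < N → N ≤ N' → x ⬝ᵥ w N' ≤ x ⬝ᵥ w N := fun N N' hN hNN' => by
    have h1 := hform N hN (w N)
    have h2 := hform N hN (w N')
    have h3 := hform N' (hN.trans_le hNN') (w N')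
    have h4 : ∑ m, ∑ k, truncate α N m k * c (w N') m k * c (w N') m k ≤ x ⬝ᵥ w N' := by
      rw [h3]
      refine Finset.sum_le_sum fun m _ => Finset.sum_le_sum fun k _ => ?_
      rw [mul_assoc, mul_assoc]
      exact mul_le_mul_of_nonneg_right (truncate_mono α hNN' m k) (mul_self_nonneg _)
    have h5 : 0 ≤ ∑ m, ∑ k, truncate α N m k * (c (w N) m k - c (w N') m k) ^ 2 :=
      Finset.sum_nonneg fun m _ => Finset.sum_nonneg fun k _ =>
        mul_nonneg (truncate_nonneg α N m k) (sq_nonneg _)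
    have h6 : ∑ m, ∑ k, truncate α N m k * (c (w N) m k - c (w N') m k) ^ 2 =
        x ⬝ᵥ w N - 2 * (x ⬝ᵥ w N') +
          ∑ m, ∑ k, truncate α N m k * c (w N') m k * c (w N') m k := by
      rw [h1, h2]
      simp only [Finset.mul_sum, ← Finset.sum_sub_distrib, ← Finset.sum_add_distrib]
      exact Finset.sum_congr rfl fun m _ => Finset.sum_congr rfl fun k _ => by ring
    linarith
  have hterm : ∀ N : ℕ, 0 < N → ∀ m k, truncate α N m k * c (w N) m k ^ 2 ≤ x ⬝ᵥ w N :=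
    fun N hN m k => by
      have hnn : ∀ m k, 0 ≤ truncate α N m k * c (w N) m k ^ 2 := fun m k =>
        mul_nonneg (truncate_nonneg α N m k) (sq_nonneg _)
      rw [hform N hN]
      simp only [mul_assoc, ← pow_two]
      exact (Finset.single_le_sum (f := fun k => truncate α N m k * c (w N) m k ^ 2)
        (fun k _ => hnn m k) (Finset.mem_univ k)).trans
        (Finset.single_le_sum (f := fun m => ∑ k, truncate α N m k * c (w N) m k ^ 2)
          (fun m _ => Finset.sum_nonneg fun k _ => hnn m k) (Finset.mem_univ m))
  have hnonneg : ∀ N : ℕ, 0 < N → 0 ≤ x ⬝ᵥ w N := fun N hN =>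
    (mul_nonneg (truncate_nonneg α N m k) (sq_nonneg _)).trans (hterm N hN m k)
  have hlim := tendsto_atTop_ciInf (f := fun N : ℕ => x ⬝ᵥ w (N + 1))
    (fun N N' h => hanti _ _ N.succ_pos (Nat.succ_le_succ h))
    ⟨0, by rintro _ ⟨N, rfl⟩; exact hnonneg _ N.succ_pos⟩
  set L := ⨅ N : ℕ, x ⬝ᵥ w (N + 1) with hL
  refine ⟨L, (tendsto_add_atTop_iff_nat 1).1 hlim, ?_⟩
  have hL0 : 0 ≤ L := ge_of_tendsto' hlim fun N => hnonneg _ N.succ_pos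
  -- The solutions stay bounded, because already the form of the first truncation is definite.
  set C := x ⬝ᵥ w 1 with hC
  have hC0 : 0 ≤ C := hnonneg 1 one_pos
  have hCN : ∀ N : ℕ, x ⬝ᵥ w (N + 1) ≤ C := fun N => hanti _ _ one_pos (by omega)
  set e : ℕ → Fin M → Fin K → ℝ := fun N m k => truncate α 1 m k * c (w (N + 1)) m k with he
  have hebd : ∀ N, e N ∈ Set.Icc (fun _ _ => -(C + 1) : Fin M → Fin K → ℝ) (fun _ _ => C + 1) := by
    intro N
    have h1 : ∀ m k, |e N m k| ≤ C + 1 := fun m k => by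
      have ht : truncate α 1 m k ≤ 1 := by
        refine ENNReal.toReal_le_of_le_ofReal zero_le_one ?_
        simp
      have h2 : truncate α 1 m k * c (w (N + 1)) m k ^ 2 ≤ C :=
        (mul_le_mul_of_nonneg_right (truncate_mono α (by omega) m k) (sq_nonneg _)).trans
          ((hterm (N + 1) N.succ_pos m k).trans (hCN N))
      have h3 : e N m k ^ 2 ≤ C := by
        calc e N m k ^ 2 = truncate α 1 m k * (truncate α 1 m k * c (w (N + 1)) m k ^ 2) := by
              rw [he]; ring
          _ ≤ 1 * (truncate α 1 m k * c (w (N + 1)) m k ^ 2) :=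
              mul_le_mul_of_nonneg_right ht
                (mul_nonneg (truncate_nonneg α 1 m k) (sq_nonneg _))
          _ ≤ C := by rwa [one_mul]
      exact abs_le_of_sq_le_sq (by nlinarith) (by linarith)
    exact ⟨fun m k => (abs_le.1 (h1 m k)).1, fun m k => (abs_le.1 (h1 m k)).2⟩
  obtain ⟨e', -, φ, hφ, he'⟩ := isCompact_Icc.tendsto_subseq hebd
  have hwe : ∀ N, w (N + 1) = (G 1)⁻¹.mulVec (∑ m, ∑ k, e N m k • (arms m k).ofLp) := fun N => by
    rw [he, ← designMatrix_mulVec, Matrix.mulVec_mulVec, Matrix.nonsing_inv_mul _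
      ((Matrix.isUnit_iff_isUnit_det _).1 (hU 1 one_pos)), Matrix.one_mulVec]
  have hcont : Continuous fun a : Fin M → Fin K → ℝ =>
      (G 1)⁻¹.mulVec (∑ m, ∑ k, a m k • (arms m k).ofLp) := by fun_prop
  obtain ⟨v, hv⟩ : ∃ v, Tendsto (fun N => w (φ N + 1)) atTop (𝓝 v) := by
    refine ⟨_, ((hcont.tendsto e').comp he').congr fun N => ?_⟩
    exact (hwe (φ N)).symm
  have hcv : ∀ m k, Tendsto (fun N => c (w (φ N + 1)) m k) atTop (𝓝 (c v m k)) := fun m k => by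
    have : Continuous fun u : Fin d → ℝ => (arms m k).ofLp ⬝ᵥ u := by fun_prop
    exact (this.tendsto v).comp hv
  have hlimφ : Tendsto (fun N => x ⬝ᵥ w (φ N + 1)) atTop (𝓝 L) := hlim.comp hφ.tendsto_atTop
  have hxv : x ⬝ᵥ v = L := tendsto_nhds_unique (hcv m k) hlimφ
  have hφ1 : Tendsto (fun N => φ N + 1) atTop atTop :=
    (tendsto_add_atTop_nat 1).comp hφ.tendsto_atTop
  have horth : ∀ m' k', α m' k' = ⊤ → c v m' k' = 0 := fun m' k' h => by
    have h1 : Tendsto (fun N => C / ((φ N + 1 : ℕ) : ℝ)) atTop (𝓝 0) :=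
      (tendsto_const_div_atTop_nhds_zero_nat C).comp hφ1
    have h2 : c v m' k' ^ 2 ≤ 0 := le_of_tendsto_of_tendsto' ((hcv m' k').pow 2) h1 fun N => by
      have h3 := (hterm (φ N + 1) (Nat.succ_pos _) m' k').trans (hCN (φ N))
      rw [truncate_of_eq_top _ h] at h3
      rwa [le_div_iff₀ (by positivity), mul_comm]
    exact pow_eq_zero_iff two_ne_zero |>.1 (le_antisymm h2 (sq_nonneg _))
  have hsum : ∑ m', ∑ k', (α m' k').toReal * c v m' k' ^ 2 ≤ L := by
    have h1 : Tendsto (fun N => ∑ m', ∑ k', (α m' k').toReal * c (w (φ N + 1)) m' k' ^ 2) atTop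
        (𝓝 (∑ m', ∑ k', (α m' k').toReal * c v m' k' ^ 2)) :=
      tendsto_finsetSum _ fun m' _ => tendsto_finsetSum _ fun k' _ =>
        ((hcv m' k').pow 2).const_mul _
    refine le_of_tendsto_of_tendsto h1 hlimφ ?_
    filter_upwards [hφ1.eventually (eventually_toReal_le_truncate α)] with N hN
    rw [hform (φ N + 1) (Nat.succ_pos _)]
    refine Finset.sum_le_sum fun m' _ => Finset.sum_le_sum fun k' _ => ?_
    rw [mul_assoc, ← pow_two]
    exact mul_le_mul_of_nonneg_right (hN m' k') (sq_nonneg _)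
  have key := hdual m k hgap v horth
  rw [← hx, hxv] at key
  have key2 : L ^ 2 ≤ gap arms θ m k ^ 2 / 2 * L :=
    key.trans (mul_le_mul_of_nonneg_left hsum (by positivity))
  rcases hL0.eq_or_lt with h0 | h0
  · rw [← h0]; positivity
  · rw [pow_two L] at key2
    exact le_of_mul_le_mul_right key2 h0

theorem inner_toLp_eq_dotProduct (x : EuclideanSpace ℝ (Fin d)) (w : Fin d → ℝ) :
    inner ℝ x (WithLp.toLp 2 w) = x.ofLp ⬝ᵥ w := by
  rw [EuclideanSpace.inner_eq_star_dotProduct, star_trivial, dotProduct_comm]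

/-- The allocation with infinite weight on the arms `κ m` and the weights `a` on the others. -/
noncomputable def allocationWithTop (κ : Fin M → Fin K) (a : Fin M → Fin K → ℝ) :
    Fin M → Fin K → ℝ≥0∞ :=
  fun m k => if k = κ m then ⊤ else ENNReal.ofReal (a m k)

/-- Weights that distinguish `θ` from all the parameters that agree with it on the optimal arms and
reverse some optimality are feasible, once the optimal arms are given infinite weight. -/
theorem isFeasible_allocationWithTop (arms : ActionSets M K d) (θ : EuclideanSpace ℝ (Fin d))
    (hM : Nonempty (Fin M)) (h_span : ∀ m, Submodule.span ℝ (Set.range (arms m)) = ⊤)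
    (κ : Fin M → Fin K) (hκ : ∀ m k, k ≠ κ m → 0 < gap arms θ m k)
    (a : Fin M → Fin K → ℝ) (ha : ∀ m k, 0 ≤ a m k) (ha0 : ∀ m, a m (κ m) = 0)
    (H : ∀ v, (∀ m, inner ℝ (arms m (κ m)) v = 0) →
      ∀ m k, gap arms θ m k < inner ℝ (arms m k) v →
        2 ≤ ∑ m', ∑ k', a m' k' * inner ℝ (arms m' k') v ^ 2) :
    IsFeasible arms θ (allocationWithTop κ a) := by
  have htop : ∀ m, allocationWithTop κ a m (κ m) = ⊤ := fun m => by simp [allocationWithTop]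
  have hreal : ∀ m k, (allocationWithTop κ a m k).toReal = a m k := fun m k => by
    by_cases h : k = κ m
    · simp [h, htop, ha0]
    · simp [allocationWithTop, h, ha m k]
  -- The hypothesis for all multiples of `w`, in homogeneous form.
  have hom : ∀ w : Fin d → ℝ, (∀ m, (arms m (κ m)).ofLp ⬝ᵥ w = 0) → ∀ m k,
      0 < gap arms θ m k → ((arms m k).ofLp ⬝ᵥ w) ^ 2 ≤ gap arms θ m k ^ 2 / 2 *
        ∑ m', ∑ k', a m' k' * ((arms m' k').ofLp ⬝ᵥ w) ^ 2 := by
    intro w hw m k hgap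
    set y := (arms m k).ofLp ⬝ᵥ w with hy
    set Q := ∑ m', ∑ k', a m' k' * ((arms m' k').ofLp ⬝ᵥ w) ^ 2 with hQ
    have hQ0 : 0 ≤ Q := Finset.sum_nonneg fun m _ => Finset.sum_nonneg fun k _ =>
      mul_nonneg (ha m k) (sq_nonneg _)
    by_cases hy0 : y = 0
    · rw [hy0, zero_pow two_ne_zero]; positivity
    have hgt : ∀ g, gap arms θ m k < g → y ^ 2 ≤ g ^ 2 / 2 * Q := by
      intro g hg
      have h1 := H (WithLp.toLp 2 ((g / y) • w)) (fun m' => by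
        rw [inner_toLp_eq_dotProduct, dotProduct_smul, hw, smul_zero]) m k (by
        rw [inner_toLp_eq_dotProduct, dotProduct_smul, ← hy, smul_eq_mul, div_mul_cancel₀ _ hy0]
        exact hg)
      have h2 : ∑ m', ∑ k', a m' k' * inner ℝ (arms m' k') (WithLp.toLp 2 ((g / y) • w)) ^ 2 =
          g ^ 2 / y ^ 2 * Q := by
        simp only [hQ, Finset.mul_sum, inner_toLp_eq_dotProduct, dotProduct_smul, smul_eq_mul]
        exact Finset.sum_congr rfl fun m _ => Finset.sum_congr rfl fun k _ => by ring
      have hy2 : 0 < y ^ 2 := by positivity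
      rw [h2, div_mul_eq_mul_div, le_div_iff₀ hy2] at h1
      linarith
    have hcont : Tendsto (fun g : ℝ => g ^ 2 / 2 * Q) (𝓝[>] (gap arms θ m k))
        (𝓝 (gap arms θ m k ^ 2 / 2 * Q)) :=
      (Continuous.tendsto (by fun_prop) _).mono_left nhdsWithin_le_nhds
    exact ge_of_tendsto hcont (eventually_mem_nhdsWithin.mono fun g hg => hgt g hg)
  refine isFeasible_of_forall_sq_le arms θ _ (fun w hw => ?_) fun m k hgap w hw => ?_
  · by_contra! hcon
    have h0 : ∀ m, (arms m (κ m)).ofLp ⬝ᵥ w = 0 := fun m => hcon m (κ m) (by simp [htop])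
    have hQ0 : ∑ m', ∑ k', a m' k' * ((arms m' k').ofLp ⬝ᵥ w) ^ 2 = 0 := by
      refine Finset.sum_eq_zero fun m _ => Finset.sum_eq_zero fun k _ => ?_
      by_cases h : allocationWithTop κ a m k = 0
      · rw [← hreal, h]; simp
      · rw [hcon m k h]; simp
    obtain ⟨m⟩ := hM
    have hall : ∀ k, (arms m k).ofLp ⬝ᵥ w = 0 := fun k => by
      by_cases h : k = κ m
      · rw [h]; exact h0 m
      · have := hom w h0 m k (hκ m k h)
        rw [hQ0, mul_zero] at this
        exact pow_eq_zero_iff two_ne_zero |>.1 (le_antisymm this (sq_nonneg _))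
    have hperp : WithLp.toLp 2 w = (0 : EuclideanSpace ℝ (Fin d)) := by
      have hle : Submodule.span ℝ (Set.range (arms m)) ≤
          (LinearMap.ker (innerₛₗ ℝ (WithLp.toLp 2 w : EuclideanSpace ℝ (Fin d)))) := by
        rw [Submodule.span_le]
        rintro _ ⟨k, rfl⟩
        simp only [SetLike.mem_coe, LinearMap.mem_ker, innerₛₗ_apply_apply]
        rw [real_inner_comm, inner_toLp_eq_dotProduct, hall]
      rw [h_span m] at hle
      have := hle (Submodule.mem_top (x := WithLp.toLp 2 w))
      simpa using this
    exact hw (by simpa using hperp)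
  · simp only [hreal]
    exact hom w (fun m' => hw m' (κ m') (htop m')) m k hgap

/-! ### Limit points of the normalised numbers of pulls -/

/-- The design normalised by `log n`, restricted to the suboptimal arms, has a limit point along any
set of horizons on which the regret is at most `r log n`; this limit point costs at most `r`. -/
theorem exists_subseq_tendsto_allocation (arms : ActionSets M K d) (π : Policy M K)
    (p : PMF (Fin M)) (θ : EuclideanSpace ℝ (Fin d))
    (κ : Fin M → Fin K) (hκ : ∀ m k, k ≠ κ m → 0 < gap arms θ m k)
    (hκ0 : ∀ m, gap arms θ m (κ m) = 0) {r : ℝ}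
    (hr : ∃ᶠ n : ℕ in atTop, regret arms π p θ n / Real.log n < r) :
    ∃ (a : Fin M → Fin K → ℝ) (φ : ℕ → ℕ), StrictMono φ ∧ (∀ m k, 0 ≤ a m k) ∧
      (∀ m, a m (κ m) = 0) ∧ ∑ m, ∑ k, gap arms θ m k * a m k ≤ r ∧
      ∀ m k, k ≠ κ m → Tendsto (fun i => expPulls arms π p θ (φ i) (φ i) (m, k) /
        Real.log (φ i : ℕ)) atTop (𝓝 (a m k)) := by
  set x : ℕ → Fin M → Fin K → ℝ := fun n m k =>
    if k = κ m then 0 else expPulls arms π p θ n n (m, k) / Real.log n with hx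
  set s : Set (Fin M → Fin K → ℝ) := {a | (∀ m k, 0 ≤ a m k) ∧ (∀ m, a m (κ m) = 0) ∧
    ∑ m, ∑ k, gap arms θ m k * a m k ≤ r} with hs
  have hclosed : IsClosed s := by
    have h1 : IsClosed {a : Fin M → Fin K → ℝ | ∀ m k, 0 ≤ a m k} := by
      simp only [Set.ofPred_forall]
      exact isClosed_iInter fun m => isClosed_iInter fun k =>
        isClosed_le continuous_const (by fun_prop)
    have h2 : IsClosed {a : Fin M → Fin K → ℝ | ∀ m, a m (κ m) = 0} := by
      simp only [Set.ofPred_forall]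
      exact isClosed_iInter fun m => isClosed_eq (by fun_prop) continuous_const
    have h3 : IsClosed {a : Fin M → Fin K → ℝ | ∑ m, ∑ k, gap arms θ m k * a m k ≤ r} :=
      isClosed_le (by fun_prop) continuous_const
    exact h1.inter (h2.inter h3)
  have hbdd : Bornology.IsBounded s := by
    refine (Metric.isBounded_Icc (0 : Fin M → Fin K → ℝ)
      (fun m k => r / gap arms θ m k)).subset fun a ⟨h1, h2, h3⟩ => ⟨h1, fun m k => ?_⟩
    by_cases h : k = κ m
    · simp [h, h2, hκ0]
    · rw [le_div_iff₀ (hκ m k h), mul_comm]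
      have hnn : ∀ m k, 0 ≤ gap arms θ m k * a m k := fun m k =>
        mul_nonneg (gap_nonneg _ _ _ _) (h1 m k)
      refine le_trans ?_ h3
      exact (Finset.single_le_sum (f := fun k => gap arms θ m k * a m k)
        (fun k _ => hnn m k) (Finset.mem_univ k)).trans
        (Finset.single_le_sum (f := fun m => ∑ k, gap arms θ m k * a m k)
          (fun m _ => Finset.sum_nonneg fun k _ => hnn m k) (Finset.mem_univ m))
  have hfreq : ∃ᶠ n in atTop, x n ∈ s := by
    refine hr.mono fun n hn => ⟨fun m k => ?_, fun m => by simp [hx], ?_⟩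
    · simp only [hx]
      split_ifs
      · exact le_rfl
      · exact div_nonneg (expPulls_nonneg _ _ _ _ _ _ _) (Real.log_natCast_nonneg n)
    · refine le_trans (le_of_eq ?_) hn.le
      rw [regret_eq_sum, Fintype.sum_prod_type, Finset.sum_div]
      refine Finset.sum_congr rfl fun m _ => ?_
      rw [Finset.sum_div]
      refine Finset.sum_congr rfl fun k _ => ?_
      by_cases h : k = κ m
      · simp [h, hκ0]
      · simp only [hx, h, if_false]; ring
  obtain ⟨a, ha, φ, hφ, hlim⟩ := tendsto_subseq_of_frequently_bounded hbdd hfreq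
  rw [hclosed.closure_eq] at ha
  refine ⟨a, φ, hφ, ha.1, ha.2.1, ha.2.2, fun m k hk => ?_⟩
  have h1 := (tendsto_pi_nhds.1 ((tendsto_pi_nhds.1 hlim) m)) k
  simpa [hx, hk] using h1

/-- A limit point of the normalised design carries the information required to distinguish `θ` from
every parameter `θ + v` that agrees with `θ` on the optimal arms and for which some optimal arm of
`θ` is no longer optimal. -/
theorem two_le_of_tendsto_allocation (arms : ActionSets M K d) (π : Policy M K)
    (hπ : IsConsistent arms π) (p : PMF (Fin M)) (hp : ∀ m, 0 < p m)
    (θ : EuclideanSpace ℝ (Fin d))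
    (κ : Fin M → Fin K) (hκ : ∀ m k, k ≠ κ m → 0 < gap arms θ m k)
    (hκ0 : ∀ m, gap arms θ m (κ m) = 0)
    {a : Fin M → Fin K → ℝ} {φ : ℕ → ℕ} (hφ : StrictMono φ)
    (hlim : ∀ m k, k ≠ κ m → Tendsto (fun i => expPulls arms π p θ (φ i) (φ i) (m, k) /
        Real.log (φ i : ℕ)) atTop (𝓝 (a m k)))
    (v : EuclideanSpace ℝ (Fin d)) (hv : ∀ m, inner ℝ (arms m (κ m)) v = 0)
    (m : Fin M) (k : Fin K) (hk : gap arms θ m k < inner ℝ (arms m k) v) :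
    2 ≤ ∑ m', ∑ k', a m' k' * inner ℝ (arms m' k') v ^ 2 := by
  have hgap' : 0 < gap arms (θ + v) m (κ m) := by
    refine lt_of_lt_of_le ?_ (inner_sub_inner_le_gap arms (θ + v) m k (κ m))
    have h0 := hκ0 m
    rw [inner_add_right, inner_add_right, hv]
    simp only [gap] at hk h0
    linarith
  have hT : Tendsto (fun i => ∑ m', ∑ k', expPulls arms π p θ (φ i) (φ i) (m', k') /
      Real.log (φ i : ℕ) * inner ℝ (arms m' k') v ^ 2) atTop
      (𝓝 (∑ m', ∑ k', a m' k' * inner ℝ (arms m' k') v ^ 2)) := by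
    refine tendsto_finsetSum _ fun m' _ => tendsto_finsetSum _ fun k' _ => ?_
    by_cases h : k' = κ m'
    · simp [h, hv]
    · exact (hlim m' k' h).mul_const _
  have hε : ∀ ε : ℝ, 0 < ε → 2 * (1 - ε) ≤ ∑ m', ∑ k', a m' k' * inner ℝ (arms m' k') v ^ 2 := by
    intro ε hε
    refine ge_of_tendsto hT ?_
    have hev := eventually_log_le_divergence arms π hπ p hp θ v m (κ m) (hκ m) hgap' hε
    filter_upwards [hφ.tendsto_atTop.eventually hev,
      hφ.tendsto_atTop.eventually (eventually_gt_atTop 1)] with i h1 h2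
    have hlog : 0 < Real.log (φ i : ℕ) := Real.log_pos (by exact_mod_cast h2)
    rw [← le_div_iff₀ hlog, Fintype.sum_prod_type] at h1
    have e : ∑ m', ∑ k', expPulls arms π p θ (φ i) (φ i) (m', k') / Real.log (φ i : ℕ) *
        inner ℝ (arms m' k') v ^ 2 = 2 * ((∑ m', ∑ k', armInner arms v (m', k') ^ 2 *
          expPulls arms π p θ (φ i) (φ i) (m', k')) / 2 / Real.log (φ i : ℕ)) := by
      simp only [Finset.sum_div, Finset.mul_sum]
      refine Finset.sum_congr rfl fun m _ => Finset.sum_congr rfl fun k _ => ?_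
      simp only [armInner]
      ring
    rw [e]
    linarith
  refine le_of_forall_pos_le_add fun ε hε' => ?_
  have := hε (ε / 2) (by positivity)
  linarith

theorem gap_pos_of_ne (arms : ActionSets M K d) (θ : EuclideanSpace ℝ (Fin d)) {m : Fin M}
    {κ : Fin K} (hκ : ∀ j, inner ℝ (arms m j) θ ≤ inner ℝ (arms m κ) θ)
    (huniq : ∀ k, (∀ j, inner ℝ (arms m j) θ ≤ inner ℝ (arms m k) θ) → k = κ)
    {k : Fin K} (hk : k ≠ κ) : 0 < gap arms θ m k := by
  refine lt_of_lt_of_le (sub_pos.2 ?_) (inner_sub_inner_le_gap arms θ m κ k)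
  by_contra! hle
  exact hk (huniq k fun j => (hκ j).trans hle)

theorem gap_eq_zero_of_forall_le (arms : ActionSets M K d) (θ : EuclideanSpace ℝ (Fin d))
    {m : Fin M} {κ : Fin K} (hκ : ∀ j, inner ℝ (arms m j) θ ≤ inner ℝ (arms m κ) θ) :
    gap arms θ m κ = 0 :=
  have : Nonempty (Fin K) := ⟨κ⟩
  le_antisymm (sub_nonpos.2 (ciSup_le hκ)) (gap_nonneg _ _ _ _)

end ContextualBandit

theorem theorem1 (M K d : ℕ) (arms : ContextualBandit.ActionSets M K d)
    (h_card : ∀ m, Function.Injective (arms m))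
    (h_span : ∀ m, Submodule.span ℝ (Set.range (arms m)) = ⊤)
    (h_norm : ∀ m k, ‖arms m k‖ ≤ 1)
    (p : PMF (Fin M)) (hp : ∀ m, 0 < p m)
    (θ : EuclideanSpace ℝ (Fin d))
    (h_unique : ∀ m, ∃! k, ∀ j, inner ℝ (arms m j) θ ≤ inner ℝ (arms m k) θ)
    (π : ContextualBandit.Policy M K) (hπ : ContextualBandit.IsConsistent arms π) :
    (ContextualBandit.allocationValue arms θ : EReal) ≤
      liminf (fun n : ℕ =>
        ((ContextualBandit.regret arms π p θ n / Real.log n : ℝ) : EReal)) atTop := by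
  open ContextualBandit in
  by_contra! hlt
  obtain ⟨r, hr1, hr2⟩ := EReal.lt_iff_exists_real_btwn.1 hlt
  have hfreq : ∃ᶠ n : ℕ in atTop, regret arms π p θ n / Real.log n < r :=
    (frequently_lt_of_liminf_lt (by isBoundedDefault) hr1).mono fun n hn =>
      EReal.coe_lt_coe_iff.1 hn
  choose κ hκ huniq using h_unique
  have hpos : ∀ m k, k ≠ κ m → 0 < gap arms θ m k := fun m k hk =>
    gap_pos_of_ne arms θ (hκ m) (huniq m) hk
  have hzero : ∀ m, gap arms θ m (κ m) = 0 := fun m => gap_eq_zero_of_forall_le arms θ (hκ m)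
  obtain ⟨a, φ, hφ, ha, ha0, hcost, hlim⟩ :=
    exists_subseq_tendsto_allocation arms π p θ κ hpos hzero hfreq
  have hfeas : IsFeasible arms θ (allocationWithTop κ a) :=
    isFeasible_allocationWithTop arms θ ⟨p.support_nonempty.some⟩ h_span κ hpos a ha ha0
      (two_le_of_tendsto_allocation arms π hπ p hp θ κ hpos hzero hφ hlim)
  have hval : allocationValue arms θ ≤ ENNReal.ofReal r := by
    refine (iInf₂_le _ hfeas).trans (le_trans (le_of_eq ?_) (ENNReal.ofReal_le_ofReal hcost))
    have hnn : ∀ m k, 0 ≤ gap arms θ m k * a m k := fun m k =>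
      mul_nonneg (gap_nonneg _ _ _ _) (ha m k)
    rw [ENNReal.ofReal_sum_of_nonneg fun m _ => Finset.sum_nonneg fun k _ => hnn m k]
    refine Finset.sum_congr rfl fun m _ => ?_
    rw [ENNReal.ofReal_sum_of_nonneg fun k _ => hnn m k]
    refine Finset.sum_congr rfl fun k _ => ?_
    by_cases h : k = κ m
    · simp [h, hzero]
    · rw [mul_comm (gap arms θ m k), ENNReal.ofReal_mul (ha m k)]
      simp [allocationWithTop, h]
  have hr0 : 0 ≤ r :=
    (Finset.sum_nonneg fun m _ => Finset.sum_nonneg fun k _ =>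
      mul_nonneg (gap_nonneg _ _ _ _) (ha m k)).trans hcost
  have hle : (allocationValue arms θ : EReal) ≤ (r : EReal) := by
    have := EReal.coe_ennreal_le_coe_ennreal_iff.2 hval
    rwa [EReal.coe_ennreal_ofReal, max_eq_left hr0] at this
  exact absurd hr2 (not_lt.2 hle)
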